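/- For an integer $n\ge 0$, let $B(n)$ denote the number of triples $(\pi_1,\pi_2,\pi_3)$ of (possibly empty) partitions whose sizes add up to $n$, such that $\pi_1$ and $\pi_2$ each have distinct parts, all of them odd, and all parts of $\pi_3$ are divisible by $4$. Then $B(27n+16)\equiv 0\pmod 3$ for all integers $n\ge 0$. -/

import Mathlib

/-- The partition triples `(π₁, π₂, π₃)` of `n`: the sizes `s 0, s 1, s 2` of the three partitions
add up to `n`, the partitions `π₁` and `π₂` consist of distinct odd parts, and every part of `π₃`
is divisible by `4`. (Each of the three partitions may be empty.) -/
def linTriples (n : ℕ) :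
    Finset (Σ s : Fin 3 → ℕ,
      Nat.Partition (s 0) × Nat.Partition (s 1) × Nat.Partition (s 2)) :=
  (Finset.Nat.antidiagonalTuple 3 n).sigma fun s =>
    Nat.Partition.oddDistincts (s 0) ×ˢ Nat.Partition.oddDistincts (s 1) ×ˢ
      Nat.Partition.restricted (s 2) (fun i => 4 ∣ i)

/-- `linB n` is the number `B(n)` of partition triples `(π₁, π₂, π₃)` of `n` such that `π₁` and
`π₂` consist of distinct odd parts and `π₃` consists of parts divisible by `4`. -/
def linB (n : ℕ) : ℕ := (linTriples n).card

/-!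
Write `e_k` for `∏ (1 - q ^ (k i))`, `i ≥ 1`, and `A` for `∏ (1 + q ^ (2 i + 1))`, `i ≥ 0`. The
generating function `B` of `linB` is `A ^ 2 / e_4`, and everything takes place in `𝔽₃⟦q⟧`, where
`f(q) ^ 3 = f(q ^ 3)` (`expand_eq_pow`).

Four theta series carry the argument: `φ(q) = ∑ q ^ (k ^ 2)`, `φ(-q ^ 2)`,
`ψ(-q) = ∑ (-1) ^ k q ^ (2 k ^ 2 + k)` and `Ω = ∑ q ^ (3 k ^ 2 + 2 k)`, all sums being over `k ∈ ℤ`.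
They are the series `theta 1 1 0`, `theta (-1) 2 0`, `theta (-1) 2 1` and `theta 1 3 2`. By Jacobi's
triple product (`jacobi_triple_product`) all four are quotients of powers of `e_1`, `e_2`, `e_4`
(for `Ω` only modulo `3`), because `e_1 e_4 A = e_2 ^ 2`. On the other hand, sorting the index `k`
modulo `3` (`theta_eq_add_add`) shows how the first three split according to the exponent modulo `3`;
for instance `φ(q) = φ(q ^ 9) + 2 q Ω(q ^ 3)`, and no exponent of `φ(-q ^ 2)` is `1` modulo `3`.

Let `T_r` (`trisect r`) send `∑ a_n q ^ n` to `∑ a_{3n+r} q ^ n`; it is linear over series in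
`q ^ 3`. Then, modulo `3`,
* `B e_2 ^ 3 = φ(q) φ(-q ^ 2)`, so `T_1 B · e_2 = 2 Ω φ(-q ^ 2) ^ 3`;
* rewriting the eta quotients, `T_1 B · ψ(-q) ^ 3 = 2 ψ(-q) ^ 2 (e_1 e_2) ^ 3`, and since
  `T_2 (ψ(-q) ^ 2) = ψ(-q) ^ 6`, `T_2 T_1 B · ψ(-q) = 2 ψ(-q) ^ 6 e_1 e_2`;
* as `e_1 e_2 = ψ(-q) φ(-q ^ 2)`, this says `T_2 T_1 B = 2 ψ(-q) ^ 6 φ(-q ^ 2)`, a series in `q ^ 3`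
  times `φ(-q ^ 2)`. Hence `T_1 T_2 T_1 B = 0`, which is the claim, as `27 n + 16` is
  `3 (3 (3 n + 1) + 2) + 1`.

The triple product is obtained from its finite form, a specialization of the `q`-binomial theorem,
by letting the number of factors grow.
-/

open PowerSeries PowerSeries.WithPiTopology Finset Filter Topology

/-! ### Gaussian binomial coefficients -/

/-- The Gaussian binomial coefficient `[n, k]` at an element `Q` of a commutative ring, defined by
its Pascal recursion so that no division is needed. It vanishes for `k > n`. -/
def gaussBinom {A : Type*} [CommRing A] (Q : A) : ℕ → ℕ → A
  | _, 0 => 1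
  | 0, _ + 1 => 0
  | n + 1, k + 1 => gaussBinom Q n k + Q ^ (k + 1) * gaussBinom Q n (k + 1)

section Gauss
variable {A : Type*} [CommRing A] (Q : A)

@[simp]
theorem gaussBinom_zero_right (n : ℕ) : gaussBinom Q n 0 = 1 := by
  cases n <;> rfl

theorem gaussBinom_succ_succ (n k : ℕ) :
    gaussBinom Q (n + 1) (k + 1) = gaussBinom Q n k + Q ^ (k + 1) * gaussBinom Q n (k + 1) := rfl

theorem gaussBinom_eq_zero_of_lt {n k : ℕ} (h : n < k) : gaussBinom Q n k = 0 := by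
  induction n generalizing k with
  | zero => obtain ⟨k, rfl⟩ := Nat.exists_eq_add_of_lt h; rfl
  | succ n ih =>
    obtain ⟨k, rfl⟩ : ∃ j, k = j + 1 := ⟨k - 1, by omega⟩
    rw [gaussBinom_succ_succ, ih (by omega), ih (by omega)]
    simp

@[simp]
theorem gaussBinom_self (n : ℕ) : gaussBinom Q n n = 1 := by
  induction n with
  | zero => rfl
  | succ n ih => rw [gaussBinom_succ_succ, ih, gaussBinom_eq_zero_of_lt Q n.lt_succ_self]; simp

/-- The `q`-binomial theorem, in homogeneous form. -/
theorem prod_add_mul_pow_eq_sum_gaussBinom (n : ℕ) (x y : A) :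
    ∏ i ∈ range n, (y + x * Q ^ i) =
      ∑ k ∈ range (n + 1), gaussBinom Q n k * Q ^ k.choose 2 * x ^ k * y ^ (n - k) := by
  induction n generalizing x with
  | zero => simp
  | succ n ih =>
    have h1 : ∏ i ∈ range n, (y + x * Q ^ (i + 1)) = ∏ i ∈ range n, (y + (x * Q) * Q ^ i) :=
      prod_congr rfl fun i _ => by ring
    have hch (k : ℕ) : (k + 1).choose 2 = k + k.choose 2 := by
      rw [Nat.choose_succ_succ' k 1, Nat.choose_one_right]
    have h2 : (∑ k ∈ range (n + 1),
          gaussBinom Q n k * Q ^ k.choose 2 * (x * Q) ^ k * y ^ (n - k)) * y =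
        ∑ k ∈ range (n + 1), gaussBinom Q n (k + 1) * Q ^ ((k + 1) + (k + 1).choose 2)
          * x ^ (k + 1) * y ^ (n - k) + y ^ (n + 1) := by
      rw [sum_range_succ (fun k => gaussBinom Q n (k + 1) * Q ^ ((k + 1) + (k + 1).choose 2)
          * x ^ (k + 1) * y ^ (n - k)), gaussBinom_eq_zero_of_lt Q n.lt_succ_self, sum_range_succ',
          add_mul, sum_mul]
      simp only [zero_mul, add_zero, gaussBinom_zero_right, pow_zero, mul_one, Nat.choose_zero_succ,
        one_mul, Nat.sub_zero, ← pow_succ]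
      congr 1
      refine sum_congr rfl fun k hk => ?_
      rw [show n - k = (n - (k + 1)) + 1 by have := mem_range.1 hk; omega]
      ring
    -- Splitting off the factor `i = 0` leaves the same product with `x * Q` in place of `x`.
    rw [prod_range_succ', h1, ih, pow_zero, mul_one, mul_add, h2, sum_mul, add_right_comm,
      ← sum_add_distrib, sum_range_succ' _ (n + 1)]
    simp only [gaussBinom_zero_right, pow_zero, mul_one, Nat.choose_zero_succ,
        one_mul, Nat.sub_zero]
    congr 1
    refine sum_congr rfl fun k _ => ?_
    rw [gaussBinom_succ_succ, hch, Nat.add_sub_add_right]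
    ring

/-- The formula `[k + l, k] = (Q; Q)_{k + l} / ((Q; Q)_k (Q; Q)_l)`, free of denominators. -/
theorem gaussBinom_mul_prod_mul_prod (k l : ℕ) :
    gaussBinom Q (k + l) k * (∏ i ∈ range k, (1 - Q ^ (i + 1))) * ∏ i ∈ range l, (1 - Q ^ (i + 1)) =
      ∏ i ∈ range (k + l), (1 - Q ^ (i + 1)) := by
  induction k generalizing l with
  | zero => simp
  | succ k ihk =>
    induction l with
    | zero => simp
    | succ l ihl =>
      have h1 := ihk (l + 1)
      rw [show k + 1 + (l + 1) = (k + 1 + l) + 1 by ring, gaussBinom_succ_succ,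
        prod_range_succ _ (k + 1 + l), ← ihl]
      rw [show k + (l + 1) = k + 1 + l by ring, ← ihl] at h1
      rw [prod_range_succ _ k, prod_range_succ _ l] at *
      linear_combination (1 - Q ^ (k + 1)) * h1

end Gauss

/-! ### Infinite products of power series -/

section Topological
variable {R : Type*} [CommRing R] [TopologicalSpace R]

/-- The infinite product `∏ (1 + c X ^ (a + d i))` over `i ≥ 0`, usually written
`(-c X ^ a; X ^ d)_∞`. For `d = 0` the product diverges and the value is junk. -/
noncomputable def qPochhammer (c : R) (a d : ℕ) : R⟦X⟧ :=
  ∏' i : ℕ, (1 + C c * X ^ (a + d * i))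

theorem multipliable_qPochhammer (c : R) (a : ℕ) {d : ℕ} (hd : d ≠ 0) :
    Multipliable fun i : ℕ => 1 + C c * (X : R⟦X⟧) ^ (a + d * i) := by
  apply multipliable_one_add_of_tendsto_order_atTop_nhds_top
  refine ENat.tendsto_nhds_top_iff_natCast_lt.mpr fun n =>
    eventually_atTop.mpr ⟨n + 1, fun m hm => ?_⟩
  have h1 : ((n + 1 : ℕ) : ℕ∞) ≤ (C c * (X : R⟦X⟧) ^ (a + d * m)).order := by
    refine PowerSeries.nat_le_order _ _ fun i hi => ?_
    rw [coeff_C_mul, coeff_X_pow, if_neg, mul_zero]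
    have : m ≤ d * m := Nat.le_mul_of_pos_left m (by omega)
    omega
  exact lt_of_lt_of_le (by exact_mod_cast Nat.lt_succ_self n) h1

theorem hasProd_qPochhammer (c : R) (a : ℕ) {d : ℕ} (hd : d ≠ 0) :
    HasProd (fun i : ℕ => 1 + C c * (X : R⟦X⟧) ^ (a + d * i)) (qPochhammer c a d) :=
  (multipliable_qPochhammer c a hd).hasProd

variable [T2Space R]

theorem X_pow_dvd_sub_of_tendsto {f : ℕ → R⟦X⟧} {g h : R⟦X⟧} {N : ℕ}
    (hf : Tendsto f atTop (𝓝 g)) (hd : ∀ᶠ m in atTop, X ^ N ∣ f m - h) : X ^ N ∣ g - h := by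
  rw [X_pow_dvd_iff]
  intro j hj
  rw [map_sub, sub_eq_zero]
  refine tendsto_nhds_unique ((tendsto_iff_coeff_tendsto R f atTop g).1 hf j)
    (tendsto_const_nhds.congr' ?_)
  filter_upwards [hd] with m hm
  rw [X_pow_dvd_iff] at hm
  have := hm j hj
  rw [map_sub, sub_eq_zero] at this
  exact this.symm

theorem eq_of_tendsto_of_X_pow_dvd_sub {f g : ℕ → R⟦X⟧} {F G : R⟦X⟧}
    (hf : Tendsto f atTop (𝓝 F)) (hg : Tendsto g atTop (𝓝 G)) (h : ∀ m, X ^ m ∣ f m - g m) :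
    F = G := by
  refine PowerSeries.ext fun n => ?_
  refine tendsto_nhds_unique ((tendsto_iff_coeff_tendsto R f atTop F).1 hf n)
    (((tendsto_iff_coeff_tendsto R g atTop G).1 hg n).congr' ?_)
  filter_upwards [eventually_gt_atTop n] with m hm
  have := X_pow_dvd_iff.1 (h m) n hm
  rw [map_sub, sub_eq_zero] at this
  exact this.symm

theorem X_pow_dvd_qPochhammer_sub_prod {d : ℕ} (hd : d ≠ 0) (n : ℕ) :
    (X : R⟦X⟧) ^ (d * (n + 1)) ∣
      qPochhammer (-1) d d - ∏ i ∈ range n, (1 - (X ^ d) ^ (i + 1)) := by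
  have key (j : ℕ) : 1 + C (-1 : R) * X ^ (d + d * j) = 1 - (X ^ d) ^ (j + 1) := by
    rw [← pow_mul, map_neg, map_one]; ring
  have h := (hasProd_qPochhammer (-1 : R) d hd).tendsto_prod_nat
  simp only [key] at h
  refine X_pow_dvd_sub_of_tendsto h ?_
  filter_upwards [eventually_ge_atTop n] with m hm
  induction m, hm using Nat.le_induction with
  | base => simp
  | succ m hm ih =>
    rw [prod_range_succ, mul_sub, mul_one, sub_right_comm, ← pow_mul]
    exact dvd_sub ih (dvd_mul_of_dvd_right (pow_dvd_pow _ (Nat.mul_le_mul_left d (by omega))) _)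

theorem isUnit_qPochhammer {c : R} {a d : ℕ} (ha : a ≠ 0) (hd : d ≠ 0) :
    IsUnit (qPochhammer c a d) := by
  have h : (X : R⟦X⟧) ^ 1 ∣ qPochhammer c a d - 1 := by
    refine X_pow_dvd_sub_of_tendsto (hasProd_qPochhammer c a hd).tendsto_prod_nat
      (.of_forall fun m => ?_)
    induction m with
    | zero => simp
    | succ m ih =>
      rw [prod_range_succ, mul_add, mul_one, add_sub_right_comm]
      exact dvd_add ih (dvd_mul_of_dvd_right (dvd_mul_of_dvd_right (pow_dvd_pow _ (by omega)) _) _)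
  rw [PowerSeries.isUnit_iff_constantCoeff]
  have := X_pow_dvd_iff.1 h 0 one_pos
  rw [map_sub, sub_eq_zero, coeff_zero_eq_constantCoeff_apply, coeff_zero_eq_constantCoeff_apply,
    map_one] at this
  rw [this]
  exact isUnit_one

/-- As `k` and `l` grow, `[k + l, k]` at `Q = X ^ d` tends to `1 / (Q; Q)_∞`. -/
theorem X_pow_dvd_gaussBinom_mul_sub_one {d : ℕ} (hd : d ≠ 0) (k l N : ℕ)
    (hk : N ≤ d * (k + 1)) (hl : N ≤ d * (l + 1)) :
    (X : R⟦X⟧) ^ N ∣ gaussBinom (X ^ d) (k + l) k * qPochhammer (-1) d d - 1 := by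
  set E : R⟦X⟧ := qPochhammer (-1) d d
  have H (n : ℕ) (hn : N ≤ d * (n + 1)) := (pow_dvd_pow (X : R⟦X⟧) hn).trans
    (X_pow_dvd_qPochhammer_sub_prod hd n)
  have hE : IsUnit E := isUnit_qPochhammer hd hd
  rw [← hE.dvd_mul_left]
  have e := gaussBinom_mul_prod_mul_prod ((X : R⟦X⟧) ^ d) k l
  obtain ⟨x, hx⟩ := H k hk
  obtain ⟨y, hy⟩ := H l hl
  obtain ⟨z, hz⟩ := H (k + l) (hk.trans (Nat.mul_le_mul_left d (by omega)))
  set G := gaussBinom ((X : R⟦X⟧) ^ d) (k + l) k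
  rw [← sub_eq_iff_eq_add.2 (sub_eq_iff_eq_add'.1 hx),
    ← sub_eq_iff_eq_add.2 (sub_eq_iff_eq_add'.1 hy),
    ← sub_eq_iff_eq_add.2 (sub_eq_iff_eq_add'.1 hz)] at e
  exact ⟨G * E * x + G * E * y - G * x * y * X ^ N - z, by linear_combination e⟩

end Topological

/-! ### Jacobi's triple product -/

section Theta
variable {R : Type*} [CommRing R]

/-- The term `s ^ k X ^ (a k ^ 2 + b k)` of a theta series. The exponent is nonnegative, so that
`Int.toNat` does no harm, when `b < a`. -/
noncomputable def thetaTerm (s : Rˣ) (a b : ℕ) (k : ℤ) : R⟦X⟧ :=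
  C ((s ^ k : Rˣ) : R) * X ^ (a * k ^ 2 + b * k).toNat

theorem abs_le_mul_sq_add_mul {a b : ℕ} (hb : b < a) (k : ℤ) : |k| ≤ a * k ^ 2 + b * k := by
  have h0 : (b : ℤ) + 1 ≤ a := by exact_mod_cast hb
  have h1 : -(b * |k|) ≤ b * k := by
    have := neg_abs_le k
    nlinarith [Int.natCast_nonneg b]
  have h2 : |k| ≤ k ^ 2 := by
    rw [← sq_abs]
    rcases (abs_nonneg k).eq_or_lt with h | h
    · rw [← h]; norm_num
    · nlinarith
  nlinarith [abs_nonneg k, Int.natCast_nonneg b, sq_nonneg k]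

theorem mul_sq_add_mul_nonneg {a b : ℕ} (hb : b < a) (k : ℤ) : 0 ≤ a * k ^ 2 + b * k :=
  (abs_nonneg k).trans (abs_le_mul_sq_add_mul hb k)

/-- The finite form of Jacobi's triple product: the `q`-binomial theorem with `2 m` factors and
`Q = X ^ (2 a)`, recentred at the middle term. -/
theorem finite_jacobi_triple_product (s : Rˣ) {a b : ℕ} (hb : b < a) (m : ℕ) :
    (∏ i ∈ range m, (1 + C (s : R) * X ^ (a + b + 2 * a * i))) *
      ∏ i ∈ range m, (1 + C ((s⁻¹ : Rˣ) : R) * X ^ (a - b + 2 * a * i)) =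
    ∑ k ∈ range (2 * m + 1), gaussBinom ((X : R⟦X⟧) ^ (2 * a)) (2 * m) k *
      thetaTerm s a b (k - m) := by
  set Q : R⟦X⟧ := X ^ (2 * a) with hQ
  set u : R⟦X⟧ := C (s : R) * X ^ (a + b) with hu
  set v : R⟦X⟧ := C ((s⁻¹ : Rˣ) : R) * X ^ (a - b) with hv
  have hss : C (s : R) * C ((s⁻¹ : Rˣ) : R) = (1 : R⟦X⟧) := by
    rw [← map_mul, Units.mul_inv, map_one]
  have huv : u * v = Q := by
    rw [hu, hv, hQ, show 2 * a = (a + b) + (a - b) by omega, pow_add]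
    linear_combination X ^ (a + b) * X ^ (a - b) * hss
  have h1 : ∏ i ∈ range m, (Q ^ m + u * Q ^ i) =
      u ^ m * Q ^ (m.choose 2) * ∏ i ∈ range m, (1 + v * Q ^ i) := by
    rw [← prod_range_reflect (fun i => 1 + v * Q ^ i), Nat.choose_two_right, ← sum_range_id,
      ← prod_pow_eq_pow_sum, show u ^ m = ∏ _i ∈ range m, u by simp, ← prod_mul_distrib,
      ← prod_mul_distrib]
    refine prod_congr rfl fun i hi => ?_
    have hm : Q ^ m = Q ^ i * Q ^ (m - 1 - i) * Q := by
      rw [← pow_add, ← pow_succ]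
      congr 1
      have := mem_range.1 hi
      omega
    linear_combination hm - Q ^ i * Q ^ (m - 1 - i) * huv
  have h2 : ∏ i ∈ range m, (Q ^ m + u * Q ^ (m + i)) =
      Q ^ (m * m) * ∏ i ∈ range m, (1 + u * Q ^ i) := by
    rw [pow_mul, show (Q ^ m) ^ m = ∏ _i ∈ range m, Q ^ m by simp, ← prod_mul_distrib]
    exact prod_congr rfl fun i _ => by rw [pow_add]; ring
  -- With `y = Q ^ m`, the factors `y + u Q ^ i` with `i < m` give, up to monomials, the factors
  -- `1 + v Q ^ j`, and those with `i ≥ m` give `1 + u Q ^ j`.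
  have h3 := prod_add_mul_pow_eq_sum_gaussBinom Q (2 * m) u (Q ^ m)
  rw [two_mul m, prod_range_add, h1, h2, ← two_mul] at h3
  have hterm : ∀ k ∈ range (2 * m + 1), gaussBinom Q (2 * m) k * Q ^ k.choose 2 * u ^ k *
      (Q ^ m) ^ (2 * m - k) = u ^ m * Q ^ (m.choose 2) * Q ^ (m * m) *
        (gaussBinom Q (2 * m) k * thetaTerm s a b (k - m)) := by
    intro k hk
    have hk : k ≤ 2 * m := by have := mem_range.1 hk; omega
    have e1 : C ((s : R)) ^ k = C (s : R) ^ m * (C ((s ^ ((k : ℤ) - m) : Rˣ) : R) : R⟦X⟧) := by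
      rw [← map_pow, ← map_pow, ← map_mul, ← Units.val_pow_eq_pow_val, ← Units.val_pow_eq_pow_val,
        ← Units.val_mul, ← zpow_natCast, ← zpow_natCast, ← zpow_add, add_sub_cancel]
    have e2 : 2 * a * k.choose 2 + (a + b) * k + 2 * a * m * (2 * m - k) =
       (a + b) * m + 2 * a * m.choose 2 + 2 * a * (m * m) +
        (a * ((k : ℤ) - m) ^ 2 + b * ((k : ℤ) - m)).toNat := by
      zify [hk]
      rw [Int.toNat_of_nonneg (mul_sq_add_mul_nonneg hb _)]
      have c (n : ℕ) : 2 * ((n.choose 2 : ℕ) : ℤ) = n * (n - 1) := by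
        induction n with
        | zero => simp
        | succ n ih => rw [Nat.choose_succ_succ' n 1, Nat.choose_one_right]; push_cast; linarith
      linear_combination (a : ℤ) * c k - a * c m
    have e3 : (X : R⟦X⟧) ^ (2 * a * k.choose 2) * X ^ ((a + b) * k) *
        X ^ (2 * a * m * (2 * m - k)) =
       X ^ ((a + b) * m) * X ^ (2 * a * m.choose 2) * X ^ (2 * a * (m * m)) *
        X ^ (a * ((k : ℤ) - m) ^ 2 + b * ((k : ℤ) - m)).toNat := by
      rw [← pow_add, ← pow_add, e2, pow_add, pow_add, pow_add]
    rw [thetaTerm, hu, mul_pow, mul_pow, e1, hQ]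
    simp only [← pow_mul]
    linear_combination gaussBinom ((X : R⟦X⟧) ^ (2 * a)) (2 * m) k * C (s : R) ^ m *
      (C ((s ^ ((k : ℤ) - m) : Rˣ) : R) : R⟦X⟧) * e3
  rw [sum_congr rfl hterm, ← mul_sum] at h3
  have hus : IsUnit (C (s : R) ^ m : R⟦X⟧) := ((s.isUnit.map C).pow m)
  have h4 : X ^ ((a + b) * m + 2 * a * m.choose 2 + 2 * a * (m * m)) *
      ((∏ i ∈ range m, (1 + u * Q ^ i)) * ∏ i ∈ range m, (1 + v * Q ^ i)) =
      X ^ ((a + b) * m + 2 * a * m.choose 2 + 2 * a * (m * m)) *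
      ∑ k ∈ range (2 * m + 1), gaussBinom Q (2 * m) k * thetaTerm s a b (k - m) := by
    refine hus.mul_left_cancel ?_
    have hup : u ^ m = C (s : R) ^ m * X ^ ((a + b) * m) := by rw [hu, mul_pow, ← pow_mul]
    have hQp (n : ℕ) : Q ^ n = X ^ (2 * a * n) := by rw [hQ, ← pow_mul]
    rw [pow_add X, pow_add X, ← hQp, ← hQp]
    rw [hup] at h3
    linear_combination h3
  have h5 := X_pow_mul_cancel h4
  rw [← h5]
  simp only [hu, hv, hQ, mul_assoc, ← pow_add, ← pow_mul]

variable [TopologicalSpace R]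

/-- The theta series `∑ s ^ k X ^ (a k ^ 2 + b k)` over `k ∈ ℤ`, meaningful for `b < a`. -/
noncomputable def theta (s : Rˣ) (a b : ℕ) : R⟦X⟧ := ∑' k : ℤ, thetaTerm s a b k

theorem hasSum_theta (s : Rˣ) {a b : ℕ} (hb : b < a) : HasSum (thetaTerm s a b) (theta s a b) := by
  refine Summable.hasSum ?_
  rw [summable_iff_summable_coeff]
  intro n
  refine summable_of_hasFiniteSupport ((Set.finite_Icc (-(n : ℤ)) n).subset fun k hk => ?_)
  rw [Function.mem_support, thetaTerm, coeff_C_mul, coeff_X_pow] at hk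
  have h1 : n = (a * k ^ 2 + b * k).toNat := by
    by_contra h
    exact hk (by rw [if_neg h, mul_zero])
  have h2 := abs_le_mul_sq_add_mul hb k
  exact abs_le.1 (by omega)

/-- Jacobi's triple product identity. -/
theorem jacobi_triple_product [T2Space R] [IsTopologicalRing R] (s : Rˣ) {a b : ℕ} (hb : b < a) :
    theta s a b = qPochhammer (s : R) (a + b) (2 * a) *
      qPochhammer ((s⁻¹ : Rˣ) : R) (a - b) (2 * a) *
      qPochhammer (-1) (2 * a) (2 * a) := by
  have ha : 2 * a ≠ 0 := by omega
  have t1 := ((hasProd_qPochhammer (s : R) (a + b) ha).tendsto_prod_nat.mul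
    (hasProd_qPochhammer ((s⁻¹ : Rˣ) : R) (a - b) ha).tendsto_prod_nat).mul
    (tendsto_const_nhds (x := qPochhammer (-1 : R) (2 * a) (2 * a)))
  have t2 : Tendsto (fun m : ℕ => ∑ k ∈ Icc (-(m : ℤ)) m, thetaTerm s a b k) atTop
      (𝓝 (theta s a b)) := (hasSum_theta s hb).comp (Finset.tendsto_Icc_neg (R := ℤ))
  refine (eq_of_tendsto_of_X_pow_dvd_sub t1 t2 fun m => ?_).symm
  have hS : ∑ k ∈ Icc (-(m : ℤ)) m, thetaTerm s a b k =
      ∑ k ∈ range (2 * m + 1), thetaTerm s a b (k - m) := by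
    symm
    refine sum_bij (fun (k : ℕ) _ => (k : ℤ) - m) ?_ ?_ ?_ ?_
    · intro k hk
      have := mem_range.1 hk
      rw [mem_Icc]; omega
    · intro k _ l _ h; simpa using h
    · intro k hk
      rw [mem_Icc] at hk
      exact ⟨(k + m).toNat, by rw [mem_range]; omega, by omega⟩
    · intros; rfl
  rw [finite_jacobi_triple_product s hb, hS, sum_mul, ← sum_sub_distrib]
  refine dvd_sum fun k hk => ?_
  have hk : k ≤ 2 * m := by have := mem_range.1 hk; omega
  obtain ⟨l, hl⟩ := Nat.exists_eq_add_of_le hk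
  -- The term with index `k - m` is divisible by `X ^ e` with `e ≥ |k - m|`, and its coefficient is
  -- `1` modulo `X ^ (m - |k - m| + 1)`.
  set e := (a * ((k : ℤ) - m) ^ 2 + b * ((k : ℤ) - m)).toNat
  have he : |(k : ℤ) - m| ≤ e := by
    have := abs_le_mul_sq_add_mul hb ((k : ℤ) - m)
    omega
  obtain ⟨z, hz⟩ := X_pow_dvd_gaussBinom_mul_sub_one (R := R) ha k l (m - e)
    ((by have := abs_le.1 he; omega : m - e ≤ k + 1).trans (Nat.le_mul_of_pos_left _ (by omega)))
    ((by have := abs_le.1 he; omega : m - e ≤ l + 1).trans (Nat.le_mul_of_pos_left _ (by omega)))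
  rw [hl, show gaussBinom (X ^ (2 * a)) (k + l) k * thetaTerm s a b (k - m) *
    qPochhammer (-1) (2 * a) (2 * a) - thetaTerm s a b (k - m) = thetaTerm s a b (k - m) *
    (gaussBinom (X ^ (2 * a)) (k + l) k * qPochhammer (-1) (2 * a) (2 * a) - 1) by
      ring, hz, thetaTerm]
  refine (pow_dvd_pow X (by omega : m ≤ e + (m - e))).trans ?_
  rw [pow_add]
  exact mul_dvd_mul (Dvd.intro_left _ rfl) (Dvd.intro _ rfl)

end Theta

/-! ### Products and theta series along residue classes -/

theorem hasSum_int_mod_three {M : Type*} [AddCommMonoid M] [TopologicalSpace M] [ContinuousAdd M]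
    {f : ℤ → M} {x y z : M} (hx : HasSum (fun k => f (3 * k)) x)
    (hy : HasSum (fun k => f (3 * k + 1)) y) (hz : HasSum (fun k => f (-(3 * k + 1))) z) :
    HasSum f (x + y + z) := by
  have i0 : Function.Injective fun k : ℤ => 3 * k := fun a b h => by simpa using h
  have i1 : Function.Injective fun k : ℤ => 3 * k + 1 := fun a b h => by simpa using h
  have i2 : Function.Injective fun k : ℤ => -(3 * k + 1) := fun a b h => by simpa using h
  have h0 := hasSum_subtype_iff_indicator.1 (i0.hasSum_range_iff.2 hx)
  have h1 := hasSum_subtype_iff_indicator.1 (i1.hasSum_range_iff.2 hy)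
  have h2 := hasSum_subtype_iff_indicator.1 (i2.hasSum_range_iff.2 hz)
  convert (h0.add h1).add h2 using 1
  funext k
  have m0 : k ∈ Set.range (fun k : ℤ => 3 * k) ↔ k % 3 = 0 :=
    ⟨by rintro ⟨j, rfl⟩; simp, fun h => ⟨k / 3, by simp only; omega⟩⟩
  have m1 : k ∈ Set.range (fun k : ℤ => 3 * k + 1) ↔ k % 3 = 1 :=
    ⟨by rintro ⟨j, rfl⟩; simp only; omega, fun h => ⟨k / 3, by simp only; omega⟩⟩
  have m2 : k ∈ Set.range (fun k : ℤ => -(3 * k + 1)) ↔ k % 3 = 2 :=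
    ⟨by rintro ⟨j, rfl⟩; simp only; omega, fun h => ⟨-(k / 3) - 1, by simp only; omega⟩⟩
  classical
  simp only [Set.indicator_apply, m0, m1, m2]
  obtain h | h | h : k % 3 = 0 ∨ k % 3 = 1 ∨ k % 3 = 2 := by omega
  all_goals simp [h]

theorem continuous_expand {R : Type*} [CommRing R] [TopologicalSpace R] {p : ℕ} (hp : p ≠ 0) :
    Continuous (expand p hp : R⟦X⟧ → R⟦X⟧) := by
  rw [continuous_iff_continuousAt]
  intro f
  rw [ContinuousAt, tendsto_iff_coeff_tendsto]
  intro n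
  simp only [coeff_expand]
  split_ifs
  · exact (continuous_coeff R _).tendsto f
  · exact tendsto_const_nhds

theorem toNat_exponent_three_mul (a b : ℕ) (k : ℤ) :
    ((a : ℤ) * (3 * k) ^ 2 + (b : ℤ) * (3 * k)).toNat =
      (((9 * a : ℕ) : ℤ) * k ^ 2 + ((3 * b : ℕ) : ℤ) * k).toNat := by
  congr 1
  push_cast
  ring

theorem toNat_exponent_three_mul_add_one {a b : ℕ} (hb : b < a) (k : ℤ) :
    ((a : ℤ) * (3 * k + 1) ^ 2 + (b : ℤ) * (3 * k + 1)).toNat =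
      a + b + (((9 * a : ℕ) : ℤ) * k ^ 2 + ((6 * a + 3 * b : ℕ) : ℤ) * k).toNat := by
  have h1 := mul_sq_add_mul_nonneg hb (3 * k + 1)
  have h2 := mul_sq_add_mul_nonneg (by omega : 6 * a + 3 * b < 9 * a) k
  rw [← Nat.cast_inj (R := ℤ), Int.toNat_of_nonneg h1, Nat.cast_add, Int.toNat_of_nonneg h2]
  push_cast
  ring

theorem toNat_exponent_neg_three_mul_add_one {a b : ℕ} (hb : b < a) (k : ℤ) :
    ((a : ℤ) * (-(3 * k + 1)) ^ 2 + (b : ℤ) * (-(3 * k + 1))).toNat =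
      a - b + (((9 * a : ℕ) : ℤ) * k ^ 2 + ((6 * a - 3 * b : ℕ) : ℤ) * k).toNat := by
  have h1 := mul_sq_add_mul_nonneg hb (-(3 * k + 1))
  have h2 := mul_sq_add_mul_nonneg (by omega : 6 * a - 3 * b < 9 * a) k
  rw [← Nat.cast_inj (R := ℤ), Int.toNat_of_nonneg h1, Nat.cast_add, Int.toNat_of_nonneg h2,
    Nat.cast_sub hb.le, Nat.cast_sub (by omega : 3 * b ≤ 6 * a)]
  push_cast
  ring

theorem expand_theta {R : Type*} [CommRing R] [TopologicalSpace R] [T2Space R]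
    {p : ℕ} (hp : p ≠ 0) (s : Rˣ) {a b : ℕ} (hb : b < a) :
    expand p hp (theta s a b) = theta s (p * a) (p * b) := by
  refine ((hasSum_theta s hb).map (expand p hp) (continuous_expand hp)).unique ?_
  convert hasSum_theta s (Nat.mul_lt_mul_of_pos_left hb (Nat.pos_of_ne_zero hp)) using 1
  funext k
  rw [Function.comp_apply, thetaTerm, thetaTerm, map_mul, map_pow, expand_X, expand_C, ← pow_mul]
  congr 2
  have := mul_sq_add_mul_nonneg (Nat.mul_lt_mul_of_pos_left hb (Nat.pos_of_ne_zero hp)) k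
  zify at this ⊢
  rw [Int.toNat_of_nonneg (mul_sq_add_mul_nonneg hb k), Int.toNat_of_nonneg this]
  ring

section General
variable {R : Type*} [CommRing R] [TopologicalSpace R] [IsTopologicalRing R] [T2Space R]

/-- Sorting the factors by the residue of the index modulo `n`. -/
theorem qPochhammer_eq_prod (c : R) (a : ℕ) {d n : ℕ} (hd : d ≠ 0) (hn : n ≠ 0) :
    qPochhammer c a d = ∏ j ∈ range n, qPochhammer c (a + d * j) (d * n) := by
  have h1 := (hasProd_qPochhammer c a hd).tendsto_prod_nat.comp
    (tendsto_id.const_mul_atTop' (Nat.pos_of_ne_zero hn))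
  have h2 := tendsto_finsetProd (range n) fun j _ =>
    (hasProd_qPochhammer c (a + d * j) (mul_ne_zero hd hn)).tendsto_prod_nat
  refine tendsto_nhds_unique h1 (h2.congr fun m => ?_)
  rw [Finset.prod_comm]
  simp only [Function.comp_apply, id]
  induction m with
  | zero => simp
  | succ m ih =>
    rw [prod_range_succ, ih, mul_add, prod_range_add, mul_one]
    congr 1
    exact prod_congr rfl fun j _ => by congr 2; ring

theorem qPochhammer_mul_neg (c : R) (a : ℕ) {d : ℕ} (hd : d ≠ 0) :
    qPochhammer c a d * qPochhammer (-c) a d = qPochhammer (-c ^ 2) (2 * a) (2 * d) := by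
  refine ((hasProd_qPochhammer c a hd).mul (hasProd_qPochhammer (-c) a hd)).unique ?_
  convert hasProd_qPochhammer (-c ^ 2) (2 * a) (mul_ne_zero two_ne_zero hd) using 2 with i
  rw [show 2 * a + 2 * d * i = (a + d * i) * 2 by ring, pow_mul, map_neg, map_neg, map_pow]
  ring

theorem qPochhammer_pow_char (p : ℕ) [Fact p.Prime] [CharP R p] (c : R) (a : ℕ) {d : ℕ}
    (hd : d ≠ 0) :
    qPochhammer c a d ^ p = qPochhammer (c ^ p) (p * a) (p * d) := by
  have h := (hasProd_qPochhammer c a hd).map (powMonoidHom p) (continuous_pow p)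
  refine h.unique ?_
  have : CharP R⟦X⟧ p := charP_of_injective_ringHom (C_injective (R := R)) p
  convert hasProd_qPochhammer (c ^ p) (p * a) (mul_ne_zero (Fact.out : p.Prime).ne_zero hd)
    using 2 with i
  simp only [Function.comp_apply, powMonoidHom_apply]
  rw [add_pow_char, mul_pow, ← pow_mul, one_pow, map_pow,
    show p * a + p * d * i = (a + d * i) * p by ring]

/-- The 3-dissection of a theta series: its terms with index `3 k`, `3 k + 1` and `-(3 k + 1)`. -/
theorem theta_eq_add_add (s : Rˣ) {a b : ℕ} (hb : b < a) :
    theta s a b = theta (s ^ 3) (9 * a) (3 * b) +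
      C (s : R) * X ^ (a + b) * theta (s ^ 3) (9 * a) (6 * a + 3 * b) +
      C ((s⁻¹ : Rˣ) : R) * X ^ (a - b) * theta (s⁻¹ ^ 3) (9 * a) (6 * a - 3 * b) := by
  have b0 : 3 * b < 9 * a := by omega
  have b1 : 6 * a + 3 * b < 9 * a := by omega
  have b2 : 6 * a - 3 * b < 9 * a := by omega
  refine (hasSum_theta s hb).unique (hasSum_int_mod_three (f := thetaTerm s a b) ?_ ?_ ?_)
  · have hf : (fun k => thetaTerm s a b (3 * k)) = thetaTerm (s ^ 3) (9 * a) (3 * b) := by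
      funext k
      rw [thetaTerm, thetaTerm, zpow_mul, zpow_ofNat, toNat_exponent_three_mul]
    rw [hf]
    exact hasSum_theta (s ^ 3) b0
  · have hf : (fun k => thetaTerm s a b (3 * k + 1)) = fun k =>
        C (s : R) * X ^ (a + b) * thetaTerm (s ^ 3) (9 * a) (6 * a + 3 * b) k := by
      funext k
      rw [thetaTerm, thetaTerm, zpow_add, zpow_mul, zpow_ofNat, zpow_one,
        toNat_exponent_three_mul_add_one hb k, pow_add, Units.val_mul, map_mul]
      ring
    rw [hf]
    have h := hasSum_theta (s ^ 3) b1
    exact h.mul_left _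
  · have hf : (fun k => thetaTerm s a b (-(3 * k + 1))) = fun k =>
        C ((s⁻¹ : Rˣ) : R) * X ^ (a - b) *
          thetaTerm (s⁻¹ ^ 3) (9 * a) (6 * a - 3 * b) k := by
      funext k
      rw [thetaTerm, thetaTerm, zpow_neg, ← inv_zpow, zpow_add, zpow_mul, zpow_ofNat, zpow_one,
        toNat_exponent_neg_three_mul_add_one hb k, pow_add, Units.val_mul, map_mul]
      ring
    rw [hf]
    have h := hasSum_theta (s⁻¹ ^ 3) b2
    exact h.mul_left _

end General

/-! ### Trisection of power series -/

section Trisection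
variable {R : Type*} [CommRing R]

/-- The linear map sending `∑ aₙ Xⁿ` to `∑ a₃ₙ₊ᵣ Xⁿ`. -/
noncomputable def trisect (r : ℕ) : R⟦X⟧ →ₗ[R] R⟦X⟧ where
  toFun f := PowerSeries.mk fun n => coeff (3 * n + r) f
  map_add' f g := by ext; simp
  map_smul' c f := by ext; simp

@[simp]
theorem coeff_trisect (r n : ℕ) (f : R⟦X⟧) : coeff n (trisect r f) = coeff (3 * n + r) f := by
  simp [trisect]

theorem coeff_X_pow_mul_expand (g : R⟦X⟧) (n : ℕ) {r j : ℕ} (hr : r < 3) (hj : j < 3) :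
    coeff (3 * n + r) (X ^ j * expand 3 three_ne_zero g) = if j = r then coeff n g else 0 := by
  rw [coeff_X_pow_mul', coeff_expand]
  by_cases h : j = r
  · subst h
    simp
  · rw [if_neg h]
    split_ifs
    · omega
    · rfl
    · rfl

theorem trisect_X_pow_mul_expand (g : R⟦X⟧) {r j : ℕ} (hr : r < 3) (hj : j < 3) :
    trisect r (X ^ j * expand 3 three_ne_zero g) = if j = r then g else 0 := by
  ext n
  rw [coeff_trisect, coeff_X_pow_mul_expand g n hr hj]
  split_ifs <;> simp

theorem eq_sum_X_pow_mul_expand_trisect (f : R⟦X⟧) :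
    f = ∑ j ∈ range 3, X ^ j * expand 3 three_ne_zero (trisect j f) := by
  ext n
  obtain ⟨m, r, hr, rfl⟩ : ∃ m r, r < 3 ∧ n = 3 * m + r := ⟨n / 3, n % 3, by omega, by omega⟩
  rw [map_sum, sum_congr rfl fun j hj => coeff_X_pow_mul_expand _ m hr (mem_range.1 hj),
    sum_ite_eq' (range 3) r, if_pos (mem_range.2 hr), coeff_trisect]

theorem trisect_expand_mul (f g : R⟦X⟧) {r : ℕ} (hr : r < 3) :
    trisect r (expand 3 three_ne_zero g * f) = g * trisect r f := by
  conv_lhs => rw [eq_sum_X_pow_mul_expand_trisect f, mul_sum, map_sum]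
  rw [sum_congr rfl fun j hj => by
    rw [mul_left_comm, ← map_mul, trisect_X_pow_mul_expand _ hr (mem_range.1 hj)],
    sum_ite_eq' (range 3) r, if_pos (mem_range.2 hr)]

end Trisection

/-- Over the prime field, substituting `X ^ p` for `X` is raising to the `p`-th power. -/
theorem expand_eq_pow {p : ℕ} [hp : Fact p.Prime] (f : (ZMod p)⟦X⟧) :
    expand p hp.out.ne_zero f = f ^ p := by
  have h := MvPowerSeries.map_frobenius_expand (R := ZMod p) (σ := Unit) p hp.out.ne_zero (f := f)
  rw [ZMod.frobenius_zmod, MvPowerSeries.map_id] at h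
  exact h

/-! ### The generating function -/

section GenFun
variable {R : Type*} [CommRing R]

theorem sum_antidiagonalTuple_three {M : Type*} [AddCommMonoid M] (n : ℕ) (f : ℕ → ℕ → ℕ → M) :
    ∑ s ∈ Finset.Nat.antidiagonalTuple 3 n, f (s 0) (s 1) (s 2) =
      ∑ p ∈ antidiagonal n, ∑ q ∈ antidiagonal p.2, f p.1 q.1 q.2 := by
  rw [← sum_sigma (antidiagonal n) (fun p => antidiagonal p.2) (fun x => f x.1.1 x.2.1 x.2.2)]
  refine sum_bij' (fun s _ => ⟨(s 0, s 1 + s 2), (s 1, s 2)⟩)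
    (fun x _ => ![x.1.1, x.2.1, x.2.2]) ?_ ?_ ?_ ?_ ?_
  · intro s hs
    rw [Finset.Nat.mem_antidiagonalTuple, Fin.sum_univ_three] at hs
    simp only [mem_sigma, HasAntidiagonal.mem_antidiagonal]
    exact ⟨by rw [← hs, add_assoc], trivial⟩
  · rintro ⟨⟨i, j⟩, ⟨k, l⟩⟩ h
    simp only [mem_sigma, HasAntidiagonal.mem_antidiagonal] at h
    rw [Finset.Nat.mem_antidiagonalTuple, Fin.sum_univ_three]
    simp
    omega
  · intro s _
    funext i
    fin_cases i <;> rfl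
  · rintro ⟨⟨i, j⟩, ⟨k, l⟩⟩ h
    simp only [mem_sigma, HasAntidiagonal.mem_antidiagonal] at h
    obtain ⟨_, rfl⟩ := h
    rfl
  · intros; rfl

theorem powerSeriesMk_linB :
    (PowerSeries.mk fun n => (linB n : R)) =
      (PowerSeries.mk fun n => ((Nat.Partition.oddDistincts n).card : R)) ^ 2 *
        PowerSeries.mk fun n => ((Nat.Partition.restricted n (4 ∣ ·)).card : R) := by
  ext n
  rw [coeff_mk, linB, linTriples, card_sigma, Nat.cast_sum, sq, mul_assoc, coeff_mul]
  simp only [card_product, Nat.cast_mul, coeff_mul, coeff_mk, mul_sum]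
  exact sum_antidiagonalTuple_three n fun i j k =>
    ((Nat.Partition.oddDistincts i).card : R) * (((Nat.Partition.oddDistincts j).card : R) *
      ((Nat.Partition.restricted k (4 ∣ ·)).card : R))

variable [TopologicalSpace R] [T2Space R]

theorem powerSeriesMk_card_oddDistincts :
    (PowerSeries.mk fun n => ((Nat.Partition.oddDistincts n).card : R)) =
      qPochhammer 1 1 2 := by
  have h := Nat.Partition.hasProd_genFun (R := R)
    (fun i c => if ¬ Even i ∧ c < 2 then (1 : R) else 0)
  have h1 : Nat.Partition.genFun (fun i c => if ¬ Even i ∧ c < 2 then (1 : R) else 0) =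
      PowerSeries.mk fun n => ((Nat.Partition.oddDistincts n).card : R) := by
    ext n
    rw [Nat.Partition.coeff_genFun, coeff_mk, Nat.Partition.oddDistincts,
      ← Nat.Partition.countRestricted_two, Nat.Partition.odds, Nat.Partition.restricted,
      Nat.Partition.countRestricted, ← filter_and, card_filter, Nat.cast_sum]
    refine sum_congr rfl fun p _ => ?_
    rw [Finsupp.prod, prod_boole]
    simp [forall_and]
  rw [h1] at h
  refine h.unique ?_
  have hinj : Function.Injective fun j : ℕ => 2 * j := fun a b h => by simpa using h
  have hterm (i : ℕ) : (1 + ∑' j, (if ¬ Even (i + 1) ∧ j + 1 < 2 then (1 : R) else 0) •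
      (X : R⟦X⟧) ^ ((i + 1) * (j + 1))) = if Even i then 1 + X ^ (i + 1) else 1 := by
    rw [tsum_eq_single 0 fun j hj => by rw [if_neg (by omega), zero_smul]]
    by_cases hi : Even i <;> simp [hi, Nat.even_add_one]
  simp only [hterm]
  refine (hinj.hasProd_iff fun i hi => if_neg fun h => hi ?_).1 ?_
  · exact ⟨i / 2, Nat.two_mul_div_two_of_even h⟩
  · rw [show (fun i => if Even i then 1 + (X : R⟦X⟧) ^ (i + 1) else 1) ∘ (fun j : ℕ => 2 * j) =
      fun j => 1 + C (1 : R) * X ^ (1 + 2 * j) by funext j; simp [add_comm]]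
    exact hasProd_qPochhammer (1 : R) 1 two_ne_zero

variable [IsTopologicalRing R]

theorem powerSeriesMk_card_restricted_dvd_mul {d : ℕ} (hd : d ≠ 0) :
    (PowerSeries.mk fun n => ((Nat.Partition.restricted n (d ∣ ·)).card : R)) *
      qPochhammer (-1) d d = 1 := by
  have h := Nat.Partition.hasProd_powerSeriesMk_card_restricted R (d ∣ ·)
  have h2 : HasProd (fun i : ℕ => if d ∣ i + 1 then 1 - (X : R⟦X⟧) ^ (i + 1) else 1)
      (qPochhammer (-1) d d) := by
    have hd' : 0 < d := Nat.pos_of_ne_zero hd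
    have hs (j : ℕ) : d * j + (d - 1) + 1 = d + d * j := by omega
    have hinj : Function.Injective fun j : ℕ => d * j + (d - 1) := fun a b h => by
      simpa [hd] using h
    refine (hinj.hasProd_iff fun i hi => if_neg fun h => hi ?_).1 ?_
    · obtain ⟨c, hc⟩ := h
      cases c with
      | zero => omega
      | succ c => exact ⟨c, by simp only; rw [mul_add] at hc; omega⟩
    · have hf : (fun i : ℕ => if d ∣ i + 1 then 1 - (X : R⟦X⟧) ^ (i + 1) else 1) ∘
          (fun j : ℕ => d * j + (d - 1)) = fun j => 1 + C (-1 : R) * X ^ (d + d * j) := by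
        funext j
        have hj : d ∣ d * j + (d - 1) + 1 := by rw [hs]; exact Dvd.intro (j + 1) (by ring)
        rw [Function.comp_apply, if_pos hj, hs, map_neg, map_one]
        ring
      rw [hf]
      exact hasProd_qPochhammer (-1 : R) d hd
  refine (h.mul h2).unique ?_
  convert hasProd_one using 1
  funext i
  split_ifs
  · simp only [pow_mul]
    exact tsum_pow_mul_one_sub_of_constantCoeff_eq_zero (by simp)
  · simp

end GenFun

/-! ### Theta series as eta quotients -/

section EtaQuotients
variable {R : Type*} [CommRing R] [TopologicalSpace R] [IsTopologicalRing R] [T2Space R]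

theorem qPochhammer_eq_mul (c : R) (a : ℕ) {d : ℕ} (hd : d ≠ 0) :
    qPochhammer c a d = qPochhammer c a (d * 2) * qPochhammer c (a + d) (d * 2) := by
  rw [qPochhammer_eq_prod c a hd two_ne_zero, prod_range_succ, prod_range_one]
  simp

/-- `e_1 e_4 A = e_2 ^ 2`, with `e_k` and `A` as in the introduction. -/
theorem qPochhammer_mul_mul_eq_sq :
    qPochhammer (-1 : R) 1 1 * qPochhammer (-1 : R) 4 4 * qPochhammer (1 : R) 1 2 =
      qPochhammer (-1 : R) 2 2 ^ 2 := by
  have h1 := qPochhammer_eq_mul (-1 : R) 1 one_ne_zero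
  have h2 := qPochhammer_eq_mul (-1 : R) 2 two_ne_zero
  have h3 := qPochhammer_mul_neg (1 : R) 1 two_ne_zero
  norm_num at h1 h2 h3
  rw [h1]
  linear_combination qPochhammer (-1) 2 2 * qPochhammer (-1) 4 4 * h3 - qPochhammer (-1) 2 2 * h2

theorem theta_one_one_zero :
    theta (1 : Rˣ) 1 0 = qPochhammer (1 : R) 1 2 ^ 2 * qPochhammer (-1 : R) 2 2 := by
  rw [jacobi_triple_product 1 one_pos]
  norm_num
  ring

theorem theta_neg_one_two_zero_mul :
    theta (-1 : Rˣ) 2 0 * qPochhammer (-1 : R) 4 4 = qPochhammer (-1 : R) 2 2 ^ 2 := by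
  have h2 := qPochhammer_eq_mul (-1 : R) 2 two_ne_zero
  rw [jacobi_triple_product (-1) two_pos]
  norm_num at h2 ⊢
  rw [h2]
  ring

theorem theta_neg_one_two_one_mul :
    theta (-1 : Rˣ) 2 1 * qPochhammer (-1 : R) 2 2 =
      qPochhammer (-1 : R) 1 1 * qPochhammer (-1 : R) 4 4 := by
  have h1 := qPochhammer_eq_mul (-1 : R) 1 one_ne_zero
  have h2 := qPochhammer_eq_mul (-1 : R) 1 two_ne_zero
  rw [jacobi_triple_product (-1) one_lt_two]
  norm_num at h1 h2 ⊢
  rw [h1, h2]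
  ring

/-- `Ω A ^ 2 = e_2 ^ 3`. In characteristic 3 the cube of `A` is `∏ (1 + X ^ (6 i + 3))`, whose
factors are those of `A` that the triple product for `Ω` misses. -/
theorem theta_one_three_two_mul [CharP R 3] :
    theta (1 : Rˣ) 3 2 * qPochhammer (1 : R) 1 2 ^ 2 = qPochhammer (-1 : R) 2 2 ^ 3 := by
  have h1 := qPochhammer_eq_prod (1 : R) 1 two_ne_zero three_ne_zero
  have h2 := qPochhammer_pow_char 3 (1 : R) 1 two_ne_zero
  have h3 := qPochhammer_pow_char 3 (-1 : R) 2 two_ne_zero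
  have hu := isUnit_qPochhammer (c := (1 : R)) one_ne_zero two_ne_zero
  rw [jacobi_triple_product 1 (by norm_num)]
  rw [prod_range_succ, prod_range_succ, prod_range_one] at h1
  norm_num [Odd.neg_one_pow (by decide : Odd 3)] at h1 h2 h3 ⊢
  rw [h3]
  refine hu.mul_left_cancel ?_
  rw [← h2] at h1
  linear_combination (-qPochhammer (-1) 6 6) * h1

end EtaQuotients

/-- The passage from `T_1 B · e_2 = 2 Ω φ₂ ^ 3` to `T_1 B · ψ ^ 3 = 2 ψ ^ 2 (e_1 e_2) ^ 3`, by
expressing all series through `e_1`, `e_2`, `e_4`. The factor `ψ ^ 2` on both sides makes the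
cofactors `ψ ^ 3` and `(e_1 e_2) ^ 3` series in `q ^ 3` modulo 3. -/
theorem eta_quotient_identity {F : Type*} [CommRing F] [IsDomain F]
    {e₁ e₂ e₄ A φ₂ ψ Ω U : F} (h₂ : e₂ ≠ 0) (h₄ : e₄ ≠ 0)
    (hA : e₁ * e₄ * A = e₂ ^ 2) (hφ : φ₂ * e₄ = e₂ ^ 2) (hψ : ψ * e₂ = e₁ * e₄)
    (hΩ : Ω * A ^ 2 = e₂ ^ 3) (hU : U * e₂ = 2 * Ω * φ₂ ^ 3) :
    U * ψ ^ 3 = 2 * (ψ ^ 2 * (e₁ * e₂) ^ 3) := by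
  have hA0 : A ≠ 0 := by
    rintro rfl
    exact pow_ne_zero 2 h₂ (by rw [← hA, mul_zero])
  have hΩ' : Ω * e₂ = (e₁ * e₄) ^ 2 := by
    refine mul_right_cancel₀ (pow_ne_zero 2 hA0) ?_
    linear_combination e₂ * hΩ - (e₁ * e₄ * A + e₂ ^ 2) * hA
  have hU' : U * e₂ ^ 2 * e₄ = 2 * e₁ ^ 2 * e₂ ^ 6 := by
    refine mul_right_cancel₀ (pow_ne_zero 2 h₄) ?_
    have hφ3 : φ₂ ^ 3 * e₄ ^ 3 = e₂ ^ 6 := by rw [← mul_pow, hφ]; ring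
    linear_combination e₂ * e₄ ^ 3 * hU + 2 * φ₂ ^ 3 * e₄ ^ 3 * hΩ' + 2 * (e₁ * e₄) ^ 2 * hφ3
  have key : U * ψ = 2 * (e₁ * e₂) ^ 3 := by
    refine mul_right_cancel₀ (pow_ne_zero 3 h₂) ?_
    linear_combination U * e₂ ^ 2 * hψ + e₁ * hU'
  linear_combination ψ ^ 2 * key

/-! ### Trisections modulo 3 -/

section ModThree

theorem theta_one_one_zero_eq_add :
    theta (1 : (ZMod 3)ˣ) 1 0 = X ^ 0 * expand 3 three_ne_zero (theta 1 3 0) +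
      X ^ 1 * expand 3 three_ne_zero (2 * theta 1 3 2) := by
  have h := theta_eq_add_add (1 : (ZMod 3)ˣ) one_pos
  rw [two_mul, map_add, expand_theta _ _ (by norm_num), expand_theta _ _ (by norm_num), h]
  norm_num
  ring

theorem theta_neg_one_two_zero_eq_add :
    theta (-1 : (ZMod 3)ˣ) 2 0 = X ^ 0 * expand 3 three_ne_zero (theta (-1) 2 0 ^ 3) +
      X ^ 2 * expand 3 three_ne_zero (-2 * theta (-1) 6 4) := by
  have h := theta_eq_add_add (-1 : (ZMod 3)ˣ) two_pos
  rw [← expand_eq_pow, neg_mul, two_mul, map_neg, map_add, expand_theta _ _ (by norm_num),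
    expand_theta _ _ (by norm_num), expand_theta _ _ (by norm_num)]
  conv_lhs => rw [h]
  norm_num [Odd.neg_one_pow (by decide : Odd 3)]
  ring

theorem theta_neg_one_two_one_eq_add :
    theta (-1 : (ZMod 3)ˣ) 2 1 =
      X ^ 0 * expand 3 three_ne_zero (theta (-1) 6 1 - X * theta (-1) 6 5) +
      X ^ 1 * expand 3 three_ne_zero (-theta (-1) 2 1 ^ 3) := by
  have h := theta_eq_add_add (-1 : (ZMod 3)ˣ) one_lt_two
  rw [← expand_eq_pow, map_neg, map_sub, map_mul, expand_X, expand_theta _ _ (by norm_num),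
    expand_theta _ _ (by norm_num), expand_theta _ _ (by norm_num), expand_theta _ _ (by norm_num)]
  conv_lhs => rw [h]
  norm_num [Odd.neg_one_pow (by decide : Odd 3)]
  ring

theorem trisect_one_theta_mul_theta :
    trisect 1 (theta (1 : (ZMod 3)ˣ) 1 0 * theta (-1 : (ZMod 3)ˣ) 2 0) =
      2 * theta 1 3 2 * theta (-1) 2 0 ^ 3 := by
  have h : theta (1 : (ZMod 3)ˣ) 1 0 * theta (-1 : (ZMod 3)ˣ) 2 0 =
      X ^ 0 * expand 3 three_ne_zero (theta 1 3 0 * theta (-1) 2 0 ^ 3 +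
        X * (2 * theta 1 3 2 * (-2 * theta (-1) 6 4))) +
      X ^ 1 * expand 3 three_ne_zero (2 * theta 1 3 2 * theta (-1) 2 0 ^ 3) +
      X ^ 2 * expand 3 three_ne_zero (theta 1 3 0 * (-2 * theta (-1) 6 4)) := by
    conv_lhs => rw [theta_one_one_zero_eq_add, theta_neg_one_two_zero_eq_add]
    simp only [map_add, map_mul, expand_X]
    ring
  rw [h, map_add, map_add, trisect_X_pow_mul_expand _ (by norm_num) (by norm_num),
    trisect_X_pow_mul_expand _ (by norm_num) (by norm_num),
    trisect_X_pow_mul_expand _ (by norm_num) (by norm_num)]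
  simp

theorem trisect_two_theta_sq :
    trisect 2 (theta (-1 : (ZMod 3)ˣ) 2 1 ^ 2) = theta (-1) 2 1 ^ 6 := by
  set f : (ZMod 3)⟦X⟧ := theta (-1) 6 1 - X * theta (-1) 6 5 with hf
  have h : theta (-1 : (ZMod 3)ˣ) 2 1 ^ 2 =
      X ^ 0 * expand 3 three_ne_zero (f ^ 2) +
      X ^ 1 * expand 3 three_ne_zero (-2 * (f * theta (-1) 2 1 ^ 3)) +
      X ^ 2 * expand 3 three_ne_zero (theta (-1) 2 1 ^ 6) := by
    conv_lhs => rw [theta_neg_one_two_one_eq_add, ← hf]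
    simp only [map_mul, map_neg, map_pow, map_ofNat]
    ring
  rw [h, map_add, map_add, trisect_X_pow_mul_expand _ (by norm_num) (by norm_num),
    trisect_X_pow_mul_expand _ (by norm_num) (by norm_num),
    trisect_X_pow_mul_expand _ (by norm_num) (by norm_num)]
  simp

theorem trisect_one_theta_neg_one_two_zero :
    trisect 1 (theta (-1 : (ZMod 3)ˣ) 2 0) = 0 := by
  rw [theta_neg_one_two_zero_eq_add, map_add,
    trisect_X_pow_mul_expand _ (by norm_num) (by norm_num),
    trisect_X_pow_mul_expand _ (by norm_num) (by norm_num)]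
  simp

/-- `B e_2 ^ 3 = φ(q) φ(-q ^ 2)`. -/
theorem powerSeriesMk_linB_mul :
    (PowerSeries.mk fun n => (linB n : ZMod 3)) * qPochhammer (-1) 2 2 ^ 3 =
      theta 1 1 0 * theta (-1) 2 0 := by
  have h := powerSeriesMk_card_restricted_dvd_mul (R := ZMod 3) four_ne_zero
  have h4 := theta_neg_one_two_zero_mul (R := ZMod 3)
  have hu := isUnit_qPochhammer (c := (-1 : ZMod 3)) four_ne_zero four_ne_zero
  refine hu.mul_left_cancel ?_
  rw [powerSeriesMk_linB, powerSeriesMk_card_oddDistincts, theta_one_one_zero]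
  linear_combination qPochhammer 1 1 2 ^ 2 * qPochhammer (-1) 2 2 ^ 3 * h -
    qPochhammer 1 1 2 ^ 2 * qPochhammer (-1) 2 2 * h4

/-- `T_2 T_1 B = 2 ψ(-q) ^ 6 φ(-q ^ 2)`, the factor `2 ψ(-q) ^ 6` being a series in `q ^ 3`. -/
theorem trisect_two_trisect_one_powerSeriesMk_linB :
    trisect 2 (trisect 1 (PowerSeries.mk fun n => (linB n : ZMod 3))) =
      expand 3 three_ne_zero (2 * theta (-1) 2 1 ^ 2) * theta (-1) 2 0 := by
  set U : (ZMod 3)⟦X⟧ := trisect 1 (PowerSeries.mk fun n => (linB n : ZMod 3))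
  set ψ : (ZMod 3)⟦X⟧ := theta (-1) 2 1
  set φ₂ : (ZMod 3)⟦X⟧ := theta (-1) 2 0
  have h₁ := (isUnit_qPochhammer (c := (-1 : ZMod 3)) one_ne_zero one_ne_zero).ne_zero
  have h₂ := (isUnit_qPochhammer (c := (-1 : ZMod 3)) two_ne_zero two_ne_zero).ne_zero
  have h₄ := (isUnit_qPochhammer (c := (-1 : ZMod 3)) four_ne_zero four_ne_zero).ne_zero
  have hψ := theta_neg_one_two_one_mul (R := ZMod 3)
  have hφ := theta_neg_one_two_zero_mul (R := ZMod 3)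
  have hψ0 : ψ ≠ 0 := by
    intro h
    exact mul_ne_zero h₁ h₄ (by rw [← hψ, show theta (-1) 2 1 = (0 : (ZMod 3)⟦X⟧) from h, zero_mul])
  have hUe : U * qPochhammer (-1) 2 2 = 2 * theta 1 3 2 * φ₂ ^ 3 := by
    rw [← trisect_one_theta_mul_theta, ← powerSeriesMk_linB_mul, ← expand_eq_pow,
      mul_comm _ (expand _ _ _), trisect_expand_mul _ _ (by norm_num), mul_comm]
  have hUψ := eta_quotient_identity h₂ h₄ qPochhammer_mul_mul_eq_sq hφ hψ
    theta_one_three_two_mul hUe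
  have hV : ψ * trisect 2 U = ψ * (2 * ψ ^ 6 * φ₂) := by
    have hψφ : ψ * φ₂ = qPochhammer (-1) 1 1 * qPochhammer (-1) 2 2 := by
      refine mul_right_cancel₀ (mul_ne_zero h₂ h₄) ?_
      linear_combination φ₂ * qPochhammer (-1) 4 4 * hψ +
        qPochhammer (-1) 1 1 * qPochhammer (-1) 4 4 * hφ
    rw [← trisect_expand_mul _ _ (by norm_num), expand_eq_pow, mul_comm, hUψ,
      ← expand_eq_pow, show 2 * (ψ ^ 2 * expand 3 three_ne_zero
        (qPochhammer (-1) 1 1 * qPochhammer (-1) 2 2)) = expand 3 three_ne_zero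
        (2 * (qPochhammer (-1) 1 1 * qPochhammer (-1) 2 2)) * ψ ^ 2 by
          rw [map_mul _ 2, map_ofNat]; ring,
      trisect_expand_mul _ _ (by norm_num), trisect_two_theta_sq, ← hψφ]
    ring
  rw [mul_left_cancel₀ hψ0 hV, map_mul, expand_eq_pow (ψ ^ 2), map_ofNat]
  ring

end ModThree

theorem theorem1p2 (n : ℕ) : linB (27 * n + 16) ≡ 0 [MOD 3] := by
  have h : trisect 1 (trisect 2 (trisect 1 (PowerSeries.mk fun n => (linB n : ZMod 3)))) = 0 := by
    rw [trisect_two_trisect_one_powerSeriesMk_linB, trisect_expand_mul _ _ (by norm_num),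
      trisect_one_theta_neg_one_two_zero, mul_zero]
  have hn := congrArg (coeff n) h
  rw [coeff_trisect, coeff_trisect, coeff_trisect, coeff_mk, map_zero] at hn
  rw [← ZMod.natCast_eq_natCast_iff, Nat.cast_zero, ← hn]
  congr 2
  ring
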